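/- Let $3\le m\le n$ and put $N=\lfloor\frac{m-1}{2}\rfloor$. Pave the $m\times n$ grid with rows $0,\dots,m-1$ and columns $0,\dots,n-1$ by the following tiles (rectangles $R\times C$): for every $0\le r<N$ the four tiles $$\{r\}\times\{r,\dots,n-2-r\},\quad \{r,\dots,m-2-r\}\times\{n-1-r\},\quad \{m-1-r\}\times\{r+1,\dots,n-1-r\},\quad \{r+1,\dots,m-1-r\}\times\{r\},$$ and the central tile $\{N,\dots,m-1-N\}\times\{N,\dots,n-1-N\}$. (These are $2m-3$ tiles if $m$ is even and $2m-1$ tiles if $m$ is odd.) Write $w_k=e^{2\pi\sqrt{-1}/k}$. To each tile with rows $r_0<\dots<r_{p-1}$ and columns $c_0<\dots<c_{q-1}$ associate the product states $$\Big(\sum_{e=0}^{p-1}w_p^{ke}|r_e\rangle\Big)\Big(\sum_{e=0}^{q-1}w_q^{le}|c_e\rangle\Big),\qquad 0\le k<p,\ 0\le l<q,\ (k,l)\neq(0,0),$$ and let $\mathcal U$ consist of all these states together with the stopper state $|S\rangle=\big(\sum_{i=0}^{m-1}|i\rangle\big)\big(\sum_{j=0}^{n-1}|j\rangle\big)$;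 this is the constructed unextendible product basis of size $mn-4\lfloor\frac{m-1}{2}\rfloor$ in $\mathbb C^m\otimes\mathbb C^n$ (states are not normalized). Then $\mathcal U$ can be perfectly distinguished by LOCC with a $\lceil\frac m2\rceil\otimes\lceil\frac m2\rceil$ maximally entangled state: if Alice and Bob share an unknown state $|\psi\rangle_{AB}\in\mathcal U$ and, in addition, the state $\sum_{j=0}^{\lceil m/2\rceil-1}|j\rangle_a|j\rangle_b$, where Alice holds $Aa$ and Bob holds $Bb$, then there is a protocol, consisting of finitely many rounds of local generalized measurements by Alice on $Aa$ or by Bob on $Bb$ with classical communication of the outcomes, that identifies $|\psi\rangle$ with probability one. -/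

import Mathlib

open scoped Matrix Kronecker

noncomputable section

/-! ## Bipartite states and finite-round LOCC protocols

A (not necessarily normalized) pure state `∑ M i j |i⟩|j⟩` of a bipartite system whose two local
computational bases are labelled by `α` and `β` is given by its coefficient matrix
`M : Matrix α β ℂ`.  A local operator `K` of Alice sends `M` to `K * M`, a local operator `L` of
Bob sends `M` to `M * Lᵀ`. -/

/-- The squared norm of a bipartite pure state. -/
def stateNormSq {α β : Type} [Fintype α] [Fintype β] (ψ : Matrix α β ℂ) : ℝ :=
  ∑ i, ∑ j, ‖ψ i j‖ ^ 2

/-- A finite-round LOCC protocol on a system with local bases `α` (Alice) and `β` (Bob), which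
finally announces an element of `X`.  In each round one of the parties performs a generalized
measurement on the local system, i.e. applies finitely many Kraus operators `K j` with
`∑ j, (K j)ᴴ * K j = 1` (the output system may depend on the outcome, so that local ancillas
can be added or systems discarded), and communicates the outcome `j`; the rest of the protocol
may depend on everything that has been communicated so far. -/
inductive LOCCProtocol (X : Type) : Type → Type → Type 1
  | announce {α β : Type} (x : X) : LOCCProtocol X α β
  | alice {α β : Type} [DecidableEq α] {k : ℕ} (α' : Fin k → Type) [∀ j, Fintype (α' j)]
      (K : (j : Fin k) → Matrix (α' j) α ℂ) (complete : ∑ j, (K j)ᴴ * K j = 1)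
      (next : (j : Fin k) → LOCCProtocol X (α' j) β) : LOCCProtocol X α β
  | bob {α β : Type} [DecidableEq β] {k : ℕ} (β' : Fin k → Type) [∀ j, Fintype (β' j)]
      (L : (j : Fin k) → Matrix (β' j) β ℂ) (complete : ∑ j, (L j)ᴴ * L j = 1)
      (next : (j : Fin k) → LOCCProtocol X α (β' j)) : LOCCProtocol X α β

open Classical in
/-- The total squared norm of the branches of the protocol, run on `ψ`, that announce `x`. -/
def LOCCProtocol.weight {X : Type} (x : X) : {α β : Type} → [Fintype α] → [Fintype β] →
    LOCCProtocol X α β → Matrix α β ℂ → ℝ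
  | _, _, _, _, .announce y, ψ => if y = x then stateNormSq ψ else 0
  | _, _, _, _, @LOCCProtocol.alice _ _ _ _ _ _ _ K _ next, ψ =>
      ∑ j, (next j).weight x (K j * ψ)
  | _, _, _, _, @LOCCProtocol.bob _ _ _ _ _ _ _ L _ next, ψ =>
      ∑ j, (next j).weight x (ψ * (L j)ᵀ)

/-- The probability that the protocol, run on the normalization of `ψ`, announces `x`. -/
def LOCCProtocol.prob {X α β : Type} [Fintype α] [Fintype β] (P : LOCCProtocol X α β)
    (ψ : Matrix α β ℂ) (x : X) : ℝ :=
  P.weight x ψ / stateNormSq ψ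

/-- A family of bipartite pure states is perfectly distinguishable by LOCC if some LOCC protocol
announces, with probability one, the label of the state it is run on. -/
def LOCCDistinguishable {X α β : Type} [Fintype α] [Fintype β] (ψ : X → Matrix α β ℂ) : Prop :=
  ∃ P : LOCCProtocol X α β, ∀ x, P.prob (ψ x) x = 1

/-- The (unnormalized) `c ⊗ c` maximally entangled state `∑ j, |j⟩|j⟩`. -/
def maxEntangled (c : ℕ) : Matrix (Fin c) (Fin c) ℂ := 1

/-- A family of bipartite pure states is perfectly distinguishable by LOCC with a `c ⊗ c`
maximally entangled state if the states `|ψ x⟩_{AB} |Φ⟩_{ab}`, with `|Φ⟩` the `c ⊗ c` maximally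
entangled state, Alice holding `Aa` and Bob holding `Bb`, are perfectly distinguishable by
LOCC. -/
def LOCCDistinguishableWith (c : ℕ) {X α β : Type} [Fintype α] [Fintype β]
    (ψ : X → Matrix α β ℂ) : Prop :=
  LOCCDistinguishable (α := α × Fin c) (β := β × Fin c) fun x => ψ x ⊗ₖ maxEntangled c

/-! ## Tile structures and the states they give -/

/-- A tile structure: a paving of the `m × n` grid by pairwise disjoint (possibly separated)
nonempty rectangles `rows t × cols t`. -/
structure TileStructure (m n : ℕ) where
  Tile : Type
  rows : Tile → Finset (Fin m)
  cols : Tile → Finset (Fin n)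
  rows_nonempty : ∀ t, (rows t).Nonempty
  cols_nonempty : ∀ t, (cols t).Nonempty
  paved : ∀ i j, ∃! t, i ∈ rows t ∧ j ∈ cols t

/-- The vector `∑ e, w_p ^ (k * e) |r_e⟩` for a set `R = {r_0 < r_1 < ⋯ < r_{p-1}}` of basis
labels, where `w_p = exp (2πi / p)`; the index `e` of `r_e` is the number of smaller elements
of `R`. -/
def fourierVec {d : ℕ} (R : Finset (Fin d)) (k : ℕ) : Fin d → ℂ := fun r =>
  if r ∈ R then
    Complex.exp (2 * Real.pi * Complex.I / (R.card : ℂ)) ^ (k * (R.filter (· < r)).card)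
  else 0

/-- Labels of the states given by a tile structure: for each tile with `p` rows and `q` columns
the pairs `(k, l) ≠ (0, 0)` with `k < p` and `l < q`, and one label for the stopper state. -/
inductive TileStructure.Label {m n : ℕ} (T : TileStructure m n) : Type
  | tile (t : T.Tile) (k : Fin (T.rows t).card) (l : Fin (T.cols t).card)
      (hkl : ¬ ((k : ℕ) = 0 ∧ (l : ℕ) = 0)) : TileStructure.Label T
  | stopper : TileStructure.Label T

/-- The states given by a tile structure: the states
`(∑ e, w_p ^ (k * e) |r_e⟩) (∑ e, w_q ^ (l * e) |c_e⟩)` with `(k, l) ≠ (0, 0)` for each tile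
`{r_0, …, r_{p-1}} × {c_0, …, c_{q-1}}`, and the stopper state `(∑ i, |i⟩) (∑ j, |j⟩)`. -/
def TileStructure.state {m n : ℕ} (T : TileStructure m n) : T.Label → Matrix (Fin m) (Fin n) ℂ
  | .tile t k l _ => Matrix.vecMulVec (fourierVec (T.rows t) k) (fourierVec (T.cols t) l)
  | .stopper => Matrix.of fun _ _ => 1

/-! ## The nested ring tile structure -/

/-- The tiles of a structure of `N` nested rings, each made of four tiles, around a center. -/
inductive RingTile (N : ℕ) : Type
  | top (r : Fin N) : RingTile N
  | right (r : Fin N) : RingTile N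
  | bottom (r : Fin N) : RingTile N
  | left (r : Fin N) : RingTile N
  | center : RingTile N

/-- Row sets: `{r}`, `{r, …, m-2-r}`, `{m-1-r}`, `{r+1, …, m-1-r}` for the four tiles of the
`r`-th ring, and `{N, …, m-1-N}` for the center. -/
def RingTile.rows {N : ℕ} (m : ℕ) : RingTile N → Finset (Fin m)
  | .top r => Finset.univ.filter fun i => (i : ℕ) = r
  | .right r => Finset.univ.filter fun i => (r : ℕ) ≤ i ∧ (i : ℕ) + r + 2 ≤ m
  | .bottom r => Finset.univ.filter fun i => (i : ℕ) + r + 1 = m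
  | .left r => Finset.univ.filter fun i => (r : ℕ) + 1 ≤ i ∧ (i : ℕ) + r + 1 ≤ m
  | .center => Finset.univ.filter fun i => N ≤ (i : ℕ) ∧ (i : ℕ) + N + 1 ≤ m

/-- Column sets: `{r, …, n-2-r}`, `{n-1-r}`, `{r+1, …, n-1-r}`, `{r}` for the four tiles of the
`r`-th ring, and `{N, …, n-1-N}` for the center. -/
def RingTile.cols {N : ℕ} (n : ℕ) : RingTile N → Finset (Fin n)
  | .top r => Finset.univ.filter fun j => (r : ℕ) ≤ j ∧ (j : ℕ) + r + 2 ≤ n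
  | .right r => Finset.univ.filter fun j => (j : ℕ) + r + 1 = n
  | .bottom r => Finset.univ.filter fun j => (r : ℕ) + 1 ≤ j ∧ (j : ℕ) + r + 1 ≤ n
  | .left r => Finset.univ.filter fun j => (j : ℕ) = r
  | .center => Finset.univ.filter fun j => N ≤ (j : ℕ) ∧ (j : ℕ) + N + 1 ≤ n

theorem RingTile.paved {m n : ℕ} (hmn : m ≤ n) (i : Fin m) (j : Fin n) :
    ∃! t : RingTile ((m - 1) / 2), i ∈ t.rows m ∧ j ∈ t.cols n := by
  obtain ⟨i, hi⟩ := i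
  obtain ⟨j, hj⟩ := j
  refine existsUnique_of_exists_of_unique ?_ ?_
  · by_cases hc : (m - 1) / 2 ≤ i ∧ i + (m - 1) / 2 + 1 ≤ m ∧
        (m - 1) / 2 ≤ j ∧ j + (m - 1) / 2 + 1 ≤ n
    · refine ⟨.center, ?_⟩
      simp only [rows, cols, Finset.mem_filter_univ]; omega
    obtain ⟨r, hr⟩ : ∃ r, r = min (min i (m - 1 - i)) (min j (n - 1 - j)) := ⟨_, rfl⟩
    have hrN : r < (m - 1) / 2 := by omega
    by_cases h1 : i = r ∧ j + r + 2 ≤ n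
    · exact ⟨.top ⟨r, hrN⟩, by simp only [rows, cols, Finset.mem_filter_univ]; omega⟩
    by_cases h2 : j + r + 1 = n ∧ i + r + 2 ≤ m
    · exact ⟨.right ⟨r, hrN⟩, by simp only [rows, cols, Finset.mem_filter_univ]; omega⟩
    by_cases h3 : i + r + 1 = m ∧ r + 1 ≤ j
    · exact ⟨.bottom ⟨r, hrN⟩, by simp only [rows, cols, Finset.mem_filter_univ]; omega⟩
    · exact ⟨.left ⟨r, hrN⟩, by simp only [rows, cols, Finset.mem_filter_univ]; omega⟩
  · rintro (⟨r, hr⟩ | ⟨r, hr⟩ | ⟨r, hr⟩ | ⟨r, hr⟩ | _) (⟨s, hs⟩ | ⟨s, hs⟩ | ⟨s, hs⟩ | ⟨s, hs⟩ | _) <;>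
      first
      | exact fun _ _ => rfl
      | simp only [rows, cols, Finset.mem_filter_univ, top.injEq, right.injEq, bottom.injEq,
          left.injEq, Fin.mk.injEq, reduceCtorEq, imp_false]
        omega

/-- The tile structure on the `m × n` grid, `3 ≤ m ≤ n`, made of `⌊(m - 1) / 2⌋` nested rings of
four tiles each around a center with two rows (`m` even) or one row (`m` odd). It has `2m - 3`
tiles if `m` is even and `2m - 1` tiles if `m` is odd. -/
def ringStructure (m n : ℕ) (hm : 3 ≤ m) (hmn : m ≤ n) : TileStructure m n where
  Tile := RingTile ((m - 1) / 2)
  rows t := t.rows m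
  cols t := t.cols n
  rows_nonempty := by
    rintro (⟨r, hr⟩ | ⟨r, hr⟩ | ⟨r, hr⟩ | ⟨r, hr⟩ | _)
    · exact ⟨⟨r, by omega⟩, by simp [RingTile.rows]⟩
    · exact ⟨⟨r, by omega⟩, by simp only [RingTile.rows, Finset.mem_filter_univ]; omega⟩
    · exact ⟨⟨m - 1 - r, by omega⟩, by simp only [RingTile.rows, Finset.mem_filter_univ]; omega⟩
    · exact ⟨⟨r + 1, by omega⟩, by simp only [RingTile.rows, Finset.mem_filter_univ]; omega⟩
    · exact ⟨⟨(m - 1) / 2, by omega⟩, by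
        simp only [RingTile.rows, Finset.mem_filter_univ]; omega⟩
  cols_nonempty := by
    rintro (⟨r, hr⟩ | ⟨r, hr⟩ | ⟨r, hr⟩ | ⟨r, hr⟩ | _)
    · exact ⟨⟨r, by omega⟩, by simp only [RingTile.cols, Finset.mem_filter_univ]; omega⟩
    · exact ⟨⟨n - 1 - r, by omega⟩, by simp only [RingTile.cols, Finset.mem_filter_univ]; omega⟩
    · exact ⟨⟨r + 1, by omega⟩, by simp only [RingTile.cols, Finset.mem_filter_univ]; omega⟩
    · exact ⟨⟨r, by omega⟩, by simp [RingTile.cols]⟩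
    · exact ⟨⟨(m - 1) / 2, by omega⟩, by
        simp only [RingTile.cols, Finset.mem_filter_univ]; omega⟩
  paved := RingTile.paved hmn

end

/-! ### Composing protocols from local measurements -/

section Protocols

variable {X α β : Type} [Fintype α] [Fintype β]

/-! Put `N = (m - 1) / 2` and sort Alice's rows into the `N + 1 = ⌈m/2⌉` classes `min i N`: each row
above `N` is alone, all rows from `N` on form one class. The entanglement is spent on giving Bob a
coherent copy of the class (`Resolvable.of_maxEntangled`), so that he can measure column and class
together.

The tiles are then split off one at a time by yes/no measurements. Bob can test for the top tile of
each ring, since its row is a class of its own. Once all tops are gone, peeling goes from the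
outermost ring inwards: the live cells of column `r` are the left tile, then those of row `m-1-r`
the bottom tile, then those of column `n-1-r` the right tile. The center remains at the end
(`resolvable_belowTops`, `resolvable_innerCells`).

When a tile is found, only its own states and the restricted stopper survive. The latter is the
missing Fourier state `(0, 0)`, so the survivors are orthogonal products whose Alice factors are
pairwise equal or orthogonal; Alice and then Bob can measure them (`TileStructure.resolvable_tile`).
-/

theorem stateNormSq_eq_trace (ψ : Matrix α β ℂ) :
    stateNormSq ψ = (ψᴴ * ψ).trace.re := by
  simp only [stateNormSq, Matrix.trace, Matrix.diag, Matrix.mul_apply, Matrix.conjTranspose_apply,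
    Complex.re_sum]
  rw [Finset.sum_comm]
  refine Finset.sum_congr rfl fun j _ => Finset.sum_congr rfl fun i _ => ?_
  rw [Complex.star_def, Complex.conj_mul']
  norm_cast

theorem stateNormSq_transpose (ψ : Matrix α β ℂ) : stateNormSq ψᵀ = stateNormSq ψ := by
  simp only [stateNormSq, Matrix.transpose_apply]
  exact Finset.sum_comm

theorem stateNormSq_zero : stateNormSq (0 : Matrix α β ℂ) = 0 := by
  simp [stateNormSq]

theorem stateNormSq_pos {ψ : Matrix α β ℂ} {i : α} {j : β} (h : ψ i j ≠ 0) :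
    0 < stateNormSq ψ := by
  refine Finset.sum_pos' (fun _ _ => Finset.sum_nonneg fun _ _ => by positivity)
    ⟨i, Finset.mem_univ _, Finset.sum_pos' (fun _ _ => by positivity) ⟨j, Finset.mem_univ _, ?_⟩⟩
  have := norm_pos_iff.2 h
  positivity

theorem sum_stateNormSq_mul [DecidableEq α] {k : ℕ} {α' : Fin k → Type} [∀ j, Fintype (α' j)]
    (K : (j : Fin k) → Matrix (α' j) α ℂ) (hK : ∑ j, (K j)ᴴ * K j = 1) (ψ : Matrix α β ℂ) :
    ∑ j, stateNormSq (K j * ψ) = stateNormSq ψ := by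
  have h : ∀ j, (K j * ψ)ᴴ * (K j * ψ) = ψᴴ * ((K j)ᴴ * K j) * ψ := fun j => by
    simp only [Matrix.conjTranspose_mul, Matrix.mul_assoc]
  simp only [stateNormSq_eq_trace, h, ← Complex.re_sum, ← Matrix.trace_sum]
  rw [← Matrix.sum_mul, ← Matrix.mul_sum, hK, Matrix.mul_one]

theorem sum_stateNormSq_mul_transpose [DecidableEq β] {k : ℕ} {β' : Fin k → Type}
    [∀ j, Fintype (β' j)] (L : (j : Fin k) → Matrix (β' j) β ℂ) (hL : ∑ j, (L j)ᴴ * L j = 1)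
    (ψ : Matrix α β ℂ) : ∑ j, stateNormSq (ψ * (L j)ᵀ) = stateNormSq ψ := by
  rw [← stateNormSq_transpose ψ, ← sum_stateNormSq_mul L hL ψᵀ]
  refine Finset.sum_congr rfl fun j _ => ?_
  rw [← stateNormSq_transpose, Matrix.transpose_mul, Matrix.transpose_transpose]

/-- Some protocol announces, with certainty, the label of the state it is run on; members of the
family that vanish impose no condition. -/
def Resolvable (ψ : X → Matrix α β ℂ) : Prop :=
  ∃ P : LOCCProtocol X α β, ∀ x, P.weight x (ψ x) = stateNormSq (ψ x)

theorem Resolvable.locc {ψ : X → Matrix α β ℂ} (h : Resolvable ψ)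
    (h0 : ∀ x, stateNormSq (ψ x) ≠ 0) : LOCCDistinguishable ψ := by
  obtain ⟨P, hP⟩ := h
  exact ⟨P, fun x => by rw [LOCCProtocol.prob, hP, div_self (h0 x)]⟩

theorem Resolvable.of_unique {ψ : X → Matrix α β ℂ} (x₀ : X) (h : ∀ x, x ≠ x₀ → ψ x = 0) :
    Resolvable ψ := by
  refine ⟨.announce x₀, fun x => ?_⟩
  rw [LOCCProtocol.weight]
  split_ifs with hx
  · rfl
  · rw [h x (Ne.symm hx), stateNormSq_zero]

theorem Resolvable.alice [DecidableEq α] {ψ : X → Matrix α β ℂ} {k : ℕ} {α' : Fin k → Type}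
    [∀ j, Fintype (α' j)] (K : (j : Fin k) → Matrix (α' j) α ℂ) (hK : ∑ j, (K j)ᴴ * K j = 1)
    (h : ∀ j, Resolvable fun x => K j * ψ x) : Resolvable ψ := by
  choose P hP using h
  refine ⟨.alice α' K hK P, fun x => ?_⟩
  rw [LOCCProtocol.weight, ← sum_stateNormSq_mul K hK]
  exact Finset.sum_congr rfl fun j _ => hP j x

theorem Resolvable.bob [DecidableEq β] {ψ : X → Matrix α β ℂ} {k : ℕ} {β' : Fin k → Type}
    [∀ j, Fintype (β' j)] (L : (j : Fin k) → Matrix (β' j) β ℂ) (hL : ∑ j, (L j)ᴴ * L j = 1)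
    (h : ∀ j, Resolvable fun x => ψ x * (L j)ᵀ) : Resolvable ψ := by
  choose P hP using h
  refine ⟨.bob β' L hL P, fun x => ?_⟩
  rw [LOCCProtocol.weight, ← sum_stateNormSq_mul_transpose L hL]
  exact Finset.sum_congr rfl fun j _ => hP j x

theorem sum_conjTranspose_mul_projections [DecidableEq α] {P : Matrix α α ℂ} (hP : Pᴴ = P)
    (hPP : P * P = P) : ∑ j, (![P, 1 - P] j)ᴴ * ![P, 1 - P] j = 1 := by
  simp [Fin.sum_univ_two, hP, hPP, Matrix.mul_sub, Matrix.sub_mul]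

theorem Resolvable.alice_projection [DecidableEq α] {ψ : X → Matrix α β ℂ} {P : Matrix α α ℂ}
    (hP : Pᴴ = P) (hPP : P * P = P) (h₁ : Resolvable fun x => P * ψ x)
    (h₂ : Resolvable fun x => (1 - P) * ψ x) : Resolvable ψ := by
  refine .alice (α' := fun _ => α) ![P, 1 - P] (sum_conjTranspose_mul_projections hP hPP)
    fun j => ?_
  fin_cases j
  exacts [h₁, h₂]

theorem Resolvable.bob_projection [DecidableEq β] {ψ : X → Matrix α β ℂ} {P : Matrix β β ℂ}
    (hP : Pᴴ = P) (hPP : P * P = P) (h₁ : Resolvable fun x => ψ x * Pᵀ)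
    (h₂ : Resolvable fun x => ψ x * (1 - P)ᵀ) : Resolvable ψ := by
  refine .bob (β' := fun _ => β) ![P, 1 - P] (sum_conjTranspose_mul_projections hP hPP)
    fun j => ?_
  fin_cases j
  exacts [h₁, h₂]

open Classical in
theorem Resolvable.alice_partition {ψ : X → Matrix α β ℂ} (S : α → Prop)
    (h₁ : Resolvable fun x => Matrix.of fun i j => if S i then ψ x i j else 0)
    (h₂ : Resolvable fun x => Matrix.of fun i j => if S i then 0 else ψ x i j) :
    Resolvable ψ := by
  refine .alice_projection (P := Matrix.diagonal fun i => if S i then 1 else 0) ?_ ?_ ?_ ?_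
  · rw [Matrix.diagonal_conjTranspose]
    congr 1; ext i; by_cases hi : S i <;> simp [hi]
  · rw [Matrix.diagonal_mul_diagonal]
    congr 1; ext i; by_cases hi : S i <;> simp [hi]
  · convert h₁ using 2
    ext i j
    simp
  · convert h₂ using 2
    ext i j
    by_cases hi : S i <;> simp [Matrix.sub_mul, hi]

open Classical in
theorem Resolvable.bob_partition {ψ : X → Matrix α β ℂ} (S : β → Prop)
    (h₁ : Resolvable fun x => Matrix.of fun i j => if S j then ψ x i j else 0)
    (h₂ : Resolvable fun x => Matrix.of fun i j => if S j then 0 else ψ x i j) :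
    Resolvable ψ := by
  refine .bob_projection (P := Matrix.diagonal fun j => if S j then 1 else 0) ?_ ?_ ?_ ?_
  · rw [Matrix.diagonal_conjTranspose]
    congr 1; ext i; by_cases hi : S i <;> simp [hi]
  · rw [Matrix.diagonal_mul_diagonal]
    congr 1; ext i; by_cases hi : S i <;> simp [hi]
  · convert h₁ using 2
    ext i j
    simp
  · convert h₂ using 2
    ext i j
    by_cases hj : S j <;> simp [Matrix.mul_sub, hj]

end Protocols

/-! ### Orthogonal product states measured by Alice, then Bob -/

section OrthogonalProducts

open scoped ComplexOrder

/-- The orthogonal projection onto the line spanned by `u`. -/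
noncomputable def lineProjection {α : Type} [Fintype α] (u : α → ℂ) : Matrix α α ℂ :=
  (star u ⬝ᵥ u)⁻¹ • Matrix.vecMulVec u (star u)

theorem vecMulVec_mul_transpose {α β : Type} [Fintype β] (a : α → ℂ) (b : β → ℂ) (L : Matrix β β ℂ) :
    Matrix.vecMulVec a b * Lᵀ = Matrix.vecMulVec a (L *ᵥ b) := by
  rw [Matrix.vecMulVec_mul, Matrix.vecMul_transpose]

variable {X α β : Type} [Fintype α] [Fintype β]

theorem lineProjection_mulVec (u v : α → ℂ) :
    lineProjection u *ᵥ v = ((star u ⬝ᵥ u)⁻¹ * (star u ⬝ᵥ v)) • u := by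
  rw [lineProjection, Matrix.smul_mulVec, Matrix.vecMulVec_mulVec, mul_smul]
  simp

/-- No `u ≠ 0` is needed: at `u = 0` both sides vanish. -/
theorem lineProjection_mulVec_self (u : α → ℂ) : lineProjection u *ᵥ u = u := by
  rw [lineProjection_mulVec]
  by_cases h : star u ⬝ᵥ u = 0
  · rw [dotProduct_star_self_eq_zero.1 h]
    simp
  · rw [inv_mul_cancel₀ h, one_smul]

theorem lineProjection_mulVec_of_orthogonal {u v : α → ℂ} (h : star u ⬝ᵥ v = 0) :
    lineProjection u *ᵥ v = 0 := by
  rw [lineProjection_mulVec, h, mul_zero, zero_smul]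

theorem lineProjection_conjTranspose (u : α → ℂ) : (lineProjection u)ᴴ = lineProjection u := by
  rw [lineProjection, Matrix.conjTranspose_smul, Matrix.conjTranspose_vecMulVec, star_star,
    star_inv₀, ← Matrix.star_dotProduct_star, star_star]

theorem lineProjection_mul_self (u : α → ℂ) :
    lineProjection u * lineProjection u = lineProjection u := by
  nth_rw 2 [lineProjection]
  rw [Matrix.mul_smul, Matrix.mul_vecMulVec, lineProjection_mulVec_self, ← lineProjection]

open Classical in
theorem Resolvable.of_bob_orthogonal {ι : Type} (F : ι → X) (a : ι → α → ℂ) (b : ι → β → ℂ)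
    (s : Finset ι) {ψ : X → Matrix α β ℂ} [Nonempty X]
    (hψ : ∀ i ∈ s, ψ (F i) = Matrix.vecMulVec (a i) (b i)) (hψ0 : ∀ x, x ∉ s.image F → ψ x = 0)
    (hb : ∀ i ∈ s, ∀ j ∈ s, i ≠ j → star (b i) ⬝ᵥ b j = 0) : Resolvable ψ := by
  induction s using Finset.induction_on generalizing ψ with
  | empty => exact .of_unique (Classical.arbitrary X) fun x _ => hψ0 x (by simp)
  | insert i s his ih =>
    have hi : i ∈ insert i s := Finset.mem_insert_self i s
    have hs : ∀ j ∈ s, j ∈ insert i s := fun j hj => Finset.mem_insert_of_mem hj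
    have horth : ∀ j ∈ s, star (b i) ⬝ᵥ b j = 0 := fun j hj =>
      hb i hi j (hs j hj) fun h => his (h ▸ hj)
    refine .bob_projection (lineProjection_conjTranspose (b i)) (lineProjection_mul_self (b i))
      (.of_unique (F i) fun x hx => ?_) (ih (fun j hj => ?_) (fun x hx => ?_) fun j hj k hk =>
        hb j (hs j hj) k (hs k hk))
    · by_cases hxs : x ∈ s.image F
      · obtain ⟨j, hj, rfl⟩ := Finset.mem_image.1 hxs
        rw [hψ j (hs j hj), vecMulVec_mul_transpose,
          lineProjection_mulVec_of_orthogonal (horth j hj)]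
        ext
        simp [Matrix.vecMulVec_apply]
      · rw [hψ0 x (by simp only [Finset.image_insert, Finset.mem_insert]; tauto),
          Matrix.zero_mul]
    · rw [hψ j (hs j hj), vecMulVec_mul_transpose, Matrix.sub_mulVec,
        lineProjection_mulVec_of_orthogonal (horth j hj), Matrix.one_mulVec, sub_zero]
    · by_cases hxi : x = F i
      · rw [hxi, hψ i hi, vecMulVec_mul_transpose, Matrix.sub_mulVec,
          lineProjection_mulVec_self, Matrix.one_mulVec, sub_self]
        ext
        simp [Matrix.vecMulVec_apply]
      · rw [hψ0 x (by simp only [Finset.image_insert, Finset.mem_insert]; tauto),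
          Matrix.zero_mul]

-- Alice tests for one line at a time. A positive outcome leaves states with a common Alice factor,
-- hence orthogonal Bob factors; a negative outcome leaves fewer states, all unchanged.
open Classical in
theorem Resolvable.of_orthogonal_products {ι : Type} (F : ι → X) (a : ι → α → ℂ) (b : ι → β → ℂ)
    (s : Finset ι) {ψ : X → Matrix α β ℂ} [Nonempty X]
    (hψ : ∀ i ∈ s, ψ (F i) = Matrix.vecMulVec (a i) (b i)) (hψ0 : ∀ x, x ∉ s.image F → ψ x = 0)
    (hab : ∀ i ∈ s, ∀ j ∈ s, i ≠ j →
      (a i = a j ∧ star (b i) ⬝ᵥ b j = 0) ∨ star (a i) ⬝ᵥ a j = 0) : Resolvable ψ := by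
  induction s using Finset.strongInduction generalizing ψ with
  | H s ih =>
    obtain rfl | ⟨i, hi⟩ := s.eq_empty_or_nonempty
    · exact .of_unique (Classical.arbitrary X) fun x _ => hψ0 x (by simp)
    -- A zero Alice factor is orthogonal even to itself, so `hab` would say nothing about Bob's
    -- factors; such an index is dropped.
    by_cases hai : a i = 0
    · refine ih (s.erase i) (Finset.erase_ssubset hi)
        (fun j hj => hψ j (Finset.mem_of_mem_erase hj)) (fun x hx => ?_)
        fun j hj k hk => hab j (Finset.mem_of_mem_erase hj) k (Finset.mem_of_mem_erase hk)
      by_cases hxs : x ∈ s.image F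
      · obtain ⟨j, hj, rfl⟩ := Finset.mem_image.1 hxs
        by_cases hji : j = i
        · rw [hji, hψ i hi, hai, Matrix.zero_vecMulVec]
        · exact absurd (Finset.mem_image_of_mem F (Finset.mem_erase.2 ⟨hji, hj⟩)) hx
      · exact hψ0 x hxs
    have hne : star (a i) ⬝ᵥ a i ≠ 0 := fun h =>
      hai (dotProduct_star_self_eq_zero.1 h)
    have horth : ∀ j ∈ s, a j ≠ a i → star (a i) ⬝ᵥ a j = 0 := fun j hj hji =>
      (hab i hi j hj fun h => hji (h ▸ rfl)).resolve_left fun h => hji h.1.symm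
    refine .alice_projection (lineProjection_conjTranspose (a i)) (lineProjection_mul_self (a i))
      (.of_bob_orthogonal F a b (s.filter fun j => a j = a i) ?_ ?_ ?_)
      (ih (s.filter fun j => a j ≠ a i) ?_ ?_ ?_ ?_)
    · intro j hj
      obtain ⟨hj, hji⟩ := Finset.mem_filter.1 hj
      rw [hψ j hj, Matrix.mul_vecMulVec, hji, lineProjection_mulVec_self]
    · intro x hx
      by_cases hxs : x ∈ s.image F
      · obtain ⟨j, hj, rfl⟩ := Finset.mem_image.1 hxs
        by_cases hji : a j = a i
        · exact absurd (Finset.mem_image_of_mem F (Finset.mem_filter.2 ⟨hj, hji⟩)) hx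
        · rw [hψ j hj, Matrix.mul_vecMulVec, lineProjection_mulVec_of_orthogonal (horth j hj hji),
            Matrix.zero_vecMulVec]
      · rw [hψ0 x hxs, Matrix.mul_zero]
    · intro j hj k hk hjk
      obtain ⟨hj, hji⟩ := Finset.mem_filter.1 hj
      obtain ⟨hk, hki⟩ := Finset.mem_filter.1 hk
      refine ((hab j hj k hk hjk).resolve_right fun h => hne ?_).2
      rwa [hji, hki] at h
    · exact Finset.filter_ssubset.2 ⟨i, hi, by simp⟩
    · intro j hj
      obtain ⟨hj, hji⟩ := Finset.mem_filter.1 hj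
      rw [hψ j hj, Matrix.mul_vecMulVec, Matrix.sub_mulVec,
        lineProjection_mulVec_of_orthogonal (horth j hj hji), Matrix.one_mulVec, sub_zero]
    · intro x hx
      by_cases hxs : x ∈ s.image F
      · obtain ⟨j, hj, rfl⟩ := Finset.mem_image.1 hxs
        by_cases hji : a j = a i
        · rw [hψ j hj, Matrix.mul_vecMulVec, hji, Matrix.sub_mulVec, lineProjection_mulVec_self,
            Matrix.one_mulVec, sub_self, Matrix.zero_vecMulVec]
        · exact absurd (Finset.mem_image_of_mem F (Finset.mem_filter.2 ⟨hj, hji⟩)) hx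
      · rw [hψ0 x hxs, Matrix.mul_zero]
    · exact fun j hj k hk =>
        hab j (Finset.mem_filter.1 hj).1 k (Finset.mem_filter.1 hk).1

end OrthogonalProducts

/-! ### Orthogonality of Fourier vectors -/

section Fourier

/-- The ranks within `R` run once through `0, …, R.card - 1`; adding a new maximum changes no
earlier rank. -/
theorem sum_card_filter_lt {d : ℕ} (R : Finset (Fin d)) (f : ℕ → ℂ) :
    ∑ r ∈ R, f (R.filter (· < r)).card = ∑ e ∈ Finset.range R.card, f e := by
  induction R using Finset.induction_on_max with
  | empty => simp
  | insert a s ha ih =>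
    have has : a ∉ s := fun h => lt_irrefl a (ha a h)
    rw [Finset.sum_insert has, Finset.card_insert_of_notMem has, Finset.sum_range_succ, ← ih,
      add_comm]
    congr 1
    · refine Finset.sum_congr rfl fun r hr => ?_
      rw [Finset.filter_insert, if_neg (ha r hr).asymm]
    · rw [Finset.filter_insert, if_neg (lt_irrefl a), Finset.filter_true_of_mem ha]

theorem sum_root_of_unity_pow {p : ℕ} (k l : ℕ) (hk : k < p) (hl : l < p) :
    ∑ e ∈ Finset.range p, star (Complex.exp (2 * Real.pi * Complex.I / (p : ℂ)) ^ (k * e)) *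
      Complex.exp (2 * Real.pi * Complex.I / (p : ℂ)) ^ (l * e) = if k = l then (p : ℂ) else 0 := by
  have hp : p ≠ 0 := by omega
  have hw := Complex.isPrimitiveRoot_exp p hp
  set w := Complex.exp (2 * Real.pi * Complex.I / (p : ℂ))
  have hw0 : w ≠ 0 := hw.ne_zero hp
  have hconj : star w = w⁻¹ := by
    rw [Complex.inv_eq_conj (Complex.norm_eq_one_of_pow_eq_one hw.pow_eq_one hp)]
    rfl
  have hterm : ∀ e, star (w ^ (k * e)) * w ^ (l * e) = (w⁻¹ ^ k * w ^ l) ^ e := fun e => by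
    rw [star_pow, hconj, mul_pow, ← pow_mul, ← pow_mul]
  simp only [hterm]
  split_ifs with hkl
  · rw [hkl, inv_pow, inv_mul_cancel₀ (pow_ne_zero _ hw0)]
    simp
  · have h1 : w⁻¹ ^ k * w ^ l - 1 ≠ 0 := fun h => hkl <| by
      rw [sub_eq_zero, inv_pow, inv_mul_eq_one₀ (pow_ne_zero _ hw0)] at h
      exact hw.pow_inj hk hl h
    refine mul_right_cancel₀ h1 ?_
    rw [geom_sum_mul, mul_pow, ← pow_mul, ← pow_mul, mul_comm k, mul_comm l, pow_mul, pow_mul,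
      inv_pow, hw.pow_eq_one]
    simp

theorem star_fourierVec_dotProduct {d : ℕ} (R : Finset (Fin d)) {k l : ℕ} (hk : k < R.card)
    (hl : l < R.card) (hkl : k ≠ l) : star (fourierVec R k) ⬝ᵥ fourierVec R l = 0 := by
  have h := sum_root_of_unity_pow k l hk hl
  rw [if_neg hkl, ← sum_card_filter_lt R (fun e =>
    star (Complex.exp (2 * Real.pi * Complex.I / (R.card : ℂ)) ^ (k * e)) *
      Complex.exp (2 * Real.pi * Complex.I / (R.card : ℂ)) ^ (l * e))] at h
  rw [← h, dotProduct, ← Finset.sum_filter_add_sum_filter_not Finset.univ (· ∈ R)]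
  rw [Finset.sum_eq_zero (s := Finset.univ.filter (¬ · ∈ R)), add_zero, Finset.filter_univ_mem]
  · refine Finset.sum_congr rfl fun r hr => ?_
    simp only [Pi.star_apply, fourierVec, if_pos hr]
  · intro r hr
    simp only [fourierVec, if_neg (Finset.mem_filter.1 hr).2, mul_zero]

theorem fourierVec_zero {d : ℕ} (R : Finset (Fin d)) (r : Fin d) :
    fourierVec R 0 r = if r ∈ R then 1 else 0 := by
  simp [fourierVec]

theorem fourierVec_ne_zero {d : ℕ} {R : Finset (Fin d)} (k : ℕ) {r : Fin d} (hr : r ∈ R) :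
    fourierVec R k r ≠ 0 := by
  rw [fourierVec, if_pos hr]
  exact pow_ne_zero _ (Complex.exp_ne_zero _)

theorem fourierVec_of_notMem {d : ℕ} {R : Finset (Fin d)} (k : ℕ) {r : Fin d} (hr : r ∉ R) :
    fourierVec R k r = 0 := if_neg hr

/-- The `a`-th vector of the orthonormal Fourier basis of `ℂ^c`. -/
noncomputable def ancillaPhase (c : ℕ) (a b : Fin c) : ℂ :=
  Complex.exp (2 * Real.pi * Complex.I / (c : ℂ)) ^ ((b : ℕ) * a) / (Real.sqrt c : ℂ)

theorem sum_star_ancillaPhase_mul {c : ℕ} (b b' : Fin c) :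
    ∑ a, star (ancillaPhase c a b) * ancillaPhase c a b' = if b = b' then 1 else 0 := by
  have hc : (c : ℂ) ≠ 0 := by exact_mod_cast (Fin.pos b).ne'
  have hs : (Real.sqrt c : ℂ) * (Real.sqrt c : ℂ) = c := by
    rw [← Complex.ofReal_mul, Real.mul_self_sqrt (Nat.cast_nonneg c), Complex.ofReal_natCast]
  have h := sum_root_of_unity_pow (b : ℕ) b' b.2 b'.2
  rw [Finset.sum_range] at h
  have : ∀ a, star (ancillaPhase c a b) * ancillaPhase c a b' =
      star (Complex.exp (2 * Real.pi * Complex.I / (c : ℂ)) ^ ((b : ℕ) * a)) *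
        Complex.exp (2 * Real.pi * Complex.I / (c : ℂ)) ^ ((b' : ℕ) * a) / c := fun a => by
    rw [ancillaPhase, ancillaPhase, star_div₀, div_mul_div_comm, Complex.star_def,
      Complex.conj_ofReal, hs]
  simp only [this]
  rw [← Finset.sum_div, h]
  by_cases hb : b = b'
  · rw [if_pos (congrArg _ hb), if_pos hb, div_self hc]
  · rw [if_neg (fun h => hb (Fin.ext h)), if_neg hb, zero_div]

theorem star_ancillaPhase_mul_self {c : ℕ} (a b : Fin c) :
    star (ancillaPhase c a b) * ancillaPhase c a b = (c : ℂ)⁻¹ := by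
  have hc : c ≠ 0 := (Fin.pos a).ne'
  have hs : (Real.sqrt c : ℂ) * (Real.sqrt c : ℂ) = c := by
    rw [← Complex.ofReal_mul, Real.mul_self_sqrt (Nat.cast_nonneg c), Complex.ofReal_natCast]
  have h1 : ‖Complex.exp (2 * Real.pi * Complex.I / (c : ℂ)) ^ ((b : ℕ) * a)‖ = 1 := by
    rw [norm_pow, Complex.norm_eq_one_of_pow_eq_one (Complex.isPrimitiveRoot_exp c hc).pow_eq_one hc,
      one_pow]
  rw [ancillaPhase, star_div₀, div_mul_div_comm, Complex.star_def,
    Complex.conj_ofReal, hs, Complex.conj_mul', h1]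
  simp

end Fourier

/-! ### Using the shared entanglement to copy row classes -/

section Shared

variable {X α β : Type} [Fintype α] [Fintype β] {c : ℕ}

open Classical in
/-- The part on the cells in `D` of the state `ψ`, with Bob holding a register that contains the
class `g i` of Alice's basis label `i`. -/
noncomputable def classifiedState (g : α → Fin c) (D : α → β → Prop) (ψ : Matrix α β ℂ) :
    Matrix α (β × Fin c) ℂ :=
  fun i p => if p.2 = g i ∧ D i p.1 then ψ i p.1 else 0

open Classical in
theorem Resolvable.of_maxEntangled {N : ℕ} {ψ : X → Matrix α β ℂ} (f : α → Fin (N + 1))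
    (h : ∀ s, Resolvable fun x => classifiedState (fun i => f i + s) (fun _ _ => True) (ψ x)) :
    Resolvable fun x => ψ x ⊗ₖ maxEntangled (N + 1) := by
  refine .alice (α' := fun _ => α)
    (fun s => Matrix.of fun i p => if p = (i, f i + s) then 1 else 0) ?_ fun s => ?_
  · ext ⟨i, a⟩ ⟨i', a'⟩
    -- For given `(i, a)` exactly one outcome has a nonzero Kraus entry, the one with `a = f i + s`.
    rw [Matrix.sum_apply, Finset.sum_eq_single (a - f i)]
    · rw [Matrix.mul_apply, Finset.sum_eq_single i]
      · simp [Matrix.one_apply, eq_comm]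
      · intro i₂ _ hi
        simp [Ne.symm hi]
      · simp
    · intro s _ hs
      rw [Matrix.mul_apply]
      refine Finset.sum_eq_zero fun i₂ _ => ?_
      have : (i, a) ≠ (i₂, f i₂ + s) := by
        rintro h
        obtain ⟨rfl, rfl⟩ := Prod.mk.inj h
        exact hs (by simp)
      simp [this]
    · simp
  · convert h s using 2 with x
    ext i ⟨j, b⟩
    rw [Matrix.mul_apply, Finset.sum_eq_single (i, f i + s)]
    · simp [classifiedState, maxEntangled, Matrix.one_apply, eq_comm]
    · intro p _ hp
      simp [hp]
    · simp

-- Bob sees only the column and the class. `hQ` says that, on the live cells `D`, these two decide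
-- `Q`, so a projection of Bob's realizes the split.
open Classical in
theorem Resolvable.classified_bob_partition {ψ : X → Matrix α β ℂ} {g : α → Fin c}
    {D D₁ D₂ : α → β → Prop} (Q : α → β → Prop)
    (hQ : ∀ i i' j, g i = g i' → D i j → D i' j → Q i j → Q i' j)
    (hD₁ : ∀ i j, D₁ i j ↔ D i j ∧ Q i j) (hD₂ : ∀ i j, D₂ i j ↔ D i j ∧ ¬ Q i j)
    (h₁ : Resolvable fun x => classifiedState g D₁ (ψ x))
    (h₂ : Resolvable fun x => classifiedState g D₂ (ψ x)) :
    Resolvable fun x => classifiedState g D (ψ x) := by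
  have key : ∀ i j, D i j → ((∃ i', g i' = g i ∧ D i' j ∧ Q i' j) ↔ Q i j) := fun i j hij =>
    ⟨fun ⟨i', hg, hD, hq⟩ => hQ i' i j hg hD hij hq, fun h => ⟨i, rfl, hij, h⟩⟩
  refine .bob_partition (fun p => ∃ i, g i = p.2 ∧ D i p.1 ∧ Q i p.1) ?_ ?_
  · convert h₁ using 2 with x
    ext i ⟨j, b⟩
    simp only [classifiedState, Matrix.of_apply, hD₁]
    by_cases hb : b = g i
    · subst hb
      by_cases hD : D i j
      · simp [key i j hD, hD]
      · simp [hD]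
    · simp [hb]
  · convert h₂ using 2 with x
    ext i ⟨j, b⟩
    simp only [classifiedState, Matrix.of_apply, hD₂]
    by_cases hb : b = g i
    · subst hb
      by_cases hD : D i j
      · simp [key i j hD, hD, ite_not]
      · simp [hD]
    · simp [hb]

open Classical in
theorem Resolvable.classified_alice_partition {ψ : X → Matrix α β ℂ} {g : α → Fin c}
    {D D₁ D₂ : α → β → Prop} (Q : α → β → Prop)
    (hQ : ∀ i j j', D i j → D i j' → Q i j → Q i j')
    (hD₁ : ∀ i j, D₁ i j ↔ D i j ∧ Q i j) (hD₂ : ∀ i j, D₂ i j ↔ D i j ∧ ¬ Q i j)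
    (h₁ : Resolvable fun x => classifiedState g D₁ (ψ x))
    (h₂ : Resolvable fun x => classifiedState g D₂ (ψ x)) :
    Resolvable fun x => classifiedState g D (ψ x) := by
  have key : ∀ i j, D i j → ((∃ j', D i j' ∧ Q i j') ↔ Q i j) := fun i j hij =>
    ⟨fun ⟨j', hD, hq⟩ => hQ i j' j hD hij hq, fun h => ⟨j, hij, h⟩⟩
  refine .alice_partition (fun i => ∃ j, D i j ∧ Q i j) ?_ ?_
  · convert h₁ using 2 with x
    ext i ⟨j, b⟩
    simp only [classifiedState, Matrix.of_apply, hD₁]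
    by_cases hD : D i j
    · simp only [key i j hD, hD]
      by_cases hq : Q i j <;> simp [hq]
    · simp [hD]
  · convert h₂ using 2 with x
    ext i ⟨j, b⟩
    simp only [classifiedState, Matrix.of_apply, hD₂]
    by_cases hD : D i j
    · simp only [key i j hD, hD]
      by_cases hq : Q i j <;> simp [hq]
    · simp [hD]

open Classical in
/-- Bob erases the class register by measuring it in the Fourier basis; this leaves a phase that
depends on Alice's basis label only. -/
theorem Resolvable.of_erased {ψ : X → Matrix α β ℂ} {g : α → Fin c} {D : α → β → Prop}
    (h : ∀ a, Resolvable fun x => (Matrix.of fun i j =>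
      if D i j then ancillaPhase c a (g i) * ψ x i j else 0 : Matrix α β ℂ)) :
    Resolvable fun x => classifiedState g D (ψ x) := by
  refine .bob (β' := fun _ => β)
    (fun a => Matrix.of fun j p => if p.1 = j then ancillaPhase c a p.2 else 0) ?_ fun a => ?_
  · ext ⟨j, b⟩ ⟨j', b'⟩
    simp only [Matrix.sum_apply, Matrix.mul_apply, Matrix.conjTranspose_apply, Matrix.of_apply]
    rw [Finset.sum_comm, Finset.sum_eq_single j]
    · by_cases hj : j = j'
      · subst hj
        simp [Matrix.one_apply, ← sum_star_ancillaPhase_mul b b']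
      · simp [hj, Ne.symm hj]
    · intro j₂ _ hj
      simp [Ne.symm hj]
    · simp
  · convert h a using 2 with x
    ext i j
    rw [Matrix.mul_apply, Finset.sum_eq_single (j, g i)]
    · simp [classifiedState, mul_comm]
    · rintro ⟨j', b⟩ _ hp
      by_cases hj : j' = j
      · subst hj
        have : b ≠ g i := fun h => hp (by rw [h])
        simp [classifiedState, this]
      · simp [hj]
    · simp

end Shared

/-! ### Splitting off and resolving a single tile -/

section Tiles

variable {m n : ℕ} (T : TileStructure m n)

instance : Nonempty T.Label := ⟨.stopper⟩

open Classical in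
theorem TileStructure.resolvable_tile {c : ℕ} (g : Fin m → Fin c) (t : T.Tile) :
    Resolvable fun x =>
      classifiedState g (fun i j => i ∈ T.rows t ∧ j ∈ T.cols t) (T.state x) := by
  refine .of_erased fun a => ?_
  -- The stopper takes the excluded pair `(0, 0)`: on the tile it is the product of the two constant
  -- Fourier vectors.
  let F : Fin (T.rows t).card × Fin (T.cols t).card → T.Label := fun p =>
    if h : ¬ ((p.1 : ℕ) = 0 ∧ (p.2 : ℕ) = 0) then .tile t p.1 p.2 h else .stopper
  have hp : 0 < (T.rows t).card := (T.rows_nonempty t).card_pos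
  have hq : 0 < (T.cols t).card := (T.cols_nonempty t).card_pos
  refine .of_orthogonal_products F
    (fun p i => ancillaPhase c a (g i) * fourierVec (T.rows t) p.1 i)
    (fun p => fourierVec (T.cols t) p.2) Finset.univ ?_ ?_ ?_
  · rintro ⟨k, l⟩ -
    ext i j
    by_cases h : ¬ ((k : ℕ) = 0 ∧ (l : ℕ) = 0)
    · simp only [F, dif_pos h, state, Matrix.of_apply, Matrix.vecMulVec_apply]
      split_ifs with hij
      · ring
      · obtain hi | hj := not_and_or.1 hij
        · rw [fourierVec_of_notMem _ hi]; ring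
        · rw [fourierVec_of_notMem _ hj]; ring
    · simp only [F, dif_neg h, state, Matrix.of_apply, Matrix.vecMulVec_apply]
      obtain ⟨hk, hl⟩ := not_not.1 h
      rw [hk, hl, fourierVec_zero, fourierVec_zero]
      by_cases hi : i ∈ T.rows t <;> by_cases hj : j ∈ T.cols t <;> simp [hi, hj]
  · intro x hx
    rcases x with ⟨t', k, l, hkl⟩ | _
    · have ht : t' ≠ t := by
        rintro rfl
        exact hx (Finset.mem_image.2 ⟨(k, l), Finset.mem_univ _, dif_pos hkl⟩)
      ext i j
      simp only [Matrix.of_apply, Matrix.zero_apply, ite_eq_right_iff]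
      intro hij
      have h' : ¬ (i ∈ T.rows t' ∧ j ∈ T.cols t') := fun h => ht ((T.paved i j).unique h hij)
      simp only [state, Matrix.vecMulVec_apply]
      obtain hi | hj := not_and_or.1 h'
      · rw [fourierVec_of_notMem _ hi]; ring
      · rw [fourierVec_of_notMem _ hj]; ring
    · exact absurd (Finset.mem_image.2
        ⟨(⟨0, hp⟩, ⟨0, hq⟩), Finset.mem_univ _, dif_neg (by simp)⟩) hx
  · rintro ⟨k, l⟩ - ⟨k', l'⟩ - hne
    by_cases hk : k = k'
    · subst hk
      refine .inl ⟨rfl, star_fourierVec_dotProduct _ l.2 l'.2 fun h => hne ?_⟩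
      exact Prod.ext rfl (Fin.ext h)
    · refine .inr ?_
      have h := star_fourierVec_dotProduct (T.rows t) k.2 k'.2 fun h => hk (Fin.ext h)
      rw [dotProduct] at h ⊢
      -- All erasure phases have squared modulus `c⁻¹`, so they only rescale Alice's inner products.
      rw [← mul_zero (c : ℂ)⁻¹, ← h, Finset.mul_sum]
      refine Finset.sum_congr rfl fun i _ => ?_
      rw [← star_ancillaPhase_mul_self a (g i)]
      simp only [Pi.star_apply, star_mul']
      ring

variable {T} {c : ℕ} {g : Fin m → Fin c} {D D' : Fin m → Fin n → Prop}

theorem TileStructure.resolvable_of_bob_removes (t : T.Tile)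
    (htD : ∀ i j, i ∈ T.rows t ∧ j ∈ T.cols t → D i j)
    (hsep : ∀ i i' j, g i = g i' → D i j → D i' j → i ∈ T.rows t ∧ j ∈ T.cols t →
      i' ∈ T.rows t ∧ j ∈ T.cols t)
    (hD' : ∀ i j, D' i j ↔ D i j ∧ ¬ (i ∈ T.rows t ∧ j ∈ T.cols t))
    (h : Resolvable fun x => classifiedState g D' (T.state x)) :
    Resolvable fun x => classifiedState g D (T.state x) :=
  .classified_bob_partition (fun i j => i ∈ T.rows t ∧ j ∈ T.cols t) hsep
    (fun i j => ⟨fun h => ⟨htD i j h, h⟩, fun h => h.2⟩) hD' (T.resolvable_tile g t) h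

theorem TileStructure.resolvable_of_alice_removes (t : T.Tile)
    (htD : ∀ i j, i ∈ T.rows t ∧ j ∈ T.cols t → D i j)
    (hsep : ∀ i j j', D i j → D i j' → i ∈ T.rows t ∧ j ∈ T.cols t →
      i ∈ T.rows t ∧ j' ∈ T.cols t)
    (hD' : ∀ i j, D' i j ↔ D i j ∧ ¬ (i ∈ T.rows t ∧ j ∈ T.cols t))
    (h : Resolvable fun x => classifiedState g D' (T.state x)) :
    Resolvable fun x => classifiedState g D (T.state x) :=
  .classified_alice_partition (fun i j => i ∈ T.rows t ∧ j ∈ T.cols t) hsep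
    (fun i j => ⟨fun h => ⟨htD i j h, h⟩, fun h => h.2⟩) hD' (T.resolvable_tile g t) h

theorem TileStructure.stateNormSq_state_kronecker_ne_zero (hm : 0 < m) (hn : 0 < n) (N : ℕ)
    (x : T.Label) : stateNormSq (T.state x ⊗ₖ maxEntangled (N + 1)) ≠ 0 := by
  obtain ⟨i, j, hij⟩ : ∃ i j, T.state x i j ≠ 0 := by
    rcases x with ⟨t, k, l, hkl⟩ | _
    · obtain ⟨i, hi⟩ := T.rows_nonempty t
      obtain ⟨j, hj⟩ := T.cols_nonempty t
      exact ⟨i, j, mul_ne_zero (fourierVec_ne_zero _ hi) (fourierVec_ne_zero _ hj)⟩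
    · exact ⟨⟨0, hm⟩, ⟨0, hn⟩, one_ne_zero⟩
  refine (stateNormSq_pos (i := (i, 0)) (j := (j, 0)) ?_).ne'
  simpa [maxEntangled] using hij

end Tiles

/-! ### Order of removal in the nested rings -/

section Rings

variable {m n : ℕ} {hm : 3 ≤ m} {hmn : m ≤ n} {c : ℕ} {g : Fin m → Fin c}

/-- The cells outside the top tiles of the first `k` rings. -/
def belowTops (m n k : ℕ) (i : Fin m) (j : Fin n) : Prop :=
  ¬ ((i : ℕ) < k ∧ (i : ℕ) ≤ j ∧ (j : ℕ) + i + 2 ≤ n)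

/-- The cells outside the first `r` rings that belong to no top tile. -/
def innerCells (m n r : ℕ) (i : Fin m) (j : Fin n) : Prop :=
  r ≤ (i : ℕ) ∧ (i : ℕ) + r + 1 ≤ m ∧ r ≤ (j : ℕ) ∧ (j : ℕ) + r + 1 ≤ n ∧
    belowTops m n ((m - 1) / 2) i j

/-- Here `k` counts the rings still present, so the induction builds the protocol from the center
outwards. -/
theorem resolvable_innerCells
    (hg : ∀ i i', g i = g i' ↔ min (i : ℕ) ((m - 1) / 2) = min (i' : ℕ) ((m - 1) / 2))
    (k : ℕ) (hk : k ≤ (m - 1) / 2) :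
    Resolvable fun x => classifiedState g (innerCells m n ((m - 1) / 2 - k))
      ((ringStructure m n hm hmn).state x) := by
  induction k with
  | zero =>
    convert (ringStructure m n hm hmn).resolvable_tile g RingTile.center using 4
    ext i
    simp only [ringStructure, RingTile.rows, RingTile.cols, Finset.mem_filter_univ, innerCells,
      belowTops]
    omega
  | succ k ih =>
    specialize ih (by omega)
    obtain ⟨r, hr⟩ : ∃ r, r = (m - 1) / 2 - (k + 1) := ⟨_, rfl⟩
    have hr1 : (m - 1) / 2 - k = r + 1 := by omega
    have hrN : r < (m - 1) / 2 := by omega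
    rw [hr1] at ih
    rw [← hr]
    -- The order matters: each removal leaves the next tile alone in its column or row.
    refine TileStructure.resolvable_of_bob_removes (RingTile.left ⟨r, hrN⟩)
      (D' := fun i j => innerCells m n r i j ∧ (j : ℕ) ≠ r) ?_ ?_ ?_ <|
      TileStructure.resolvable_of_alice_removes (RingTile.bottom ⟨r, hrN⟩)
        (D' := fun i j => innerCells m n r i j ∧ (j : ℕ) ≠ r ∧ (i : ℕ) + r + 1 ≠ m) ?_ ?_ ?_ <|
      TileStructure.resolvable_of_bob_removes (RingTile.right ⟨r, hrN⟩) ?_ ?_ ?_ ih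
    all_goals
      simp only [ringStructure, RingTile.rows, RingTile.cols, Finset.mem_filter_univ, innerCells,
        belowTops, hg]
      intros
      omega

/-- Bob can remove the top tile of ring `r` because `r < (m - 1) / 2` makes row `r` the only one in
its class. -/
theorem resolvable_belowTops
    (hg : ∀ i i', g i = g i' ↔ min (i : ℕ) ((m - 1) / 2) = min (i' : ℕ) ((m - 1) / 2))
    (k : ℕ) (hk : k ≤ (m - 1) / 2) :
    Resolvable fun x => classifiedState g (belowTops m n ((m - 1) / 2 - k))
      ((ringStructure m n hm hmn).state x) := by
  induction k with
  | zero =>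
    convert resolvable_innerCells hg _ le_rfl using 4
    ext i
    simp only [innerCells, belowTops]
    omega
  | succ k ih =>
    specialize ih (by omega)
    obtain ⟨r, hr⟩ : ∃ r, r = (m - 1) / 2 - (k + 1) := ⟨_, rfl⟩
    have hr1 : (m - 1) / 2 - k = r + 1 := by omega
    have hrN : r < (m - 1) / 2 := by omega
    rw [hr1] at ih
    rw [← hr]
    refine TileStructure.resolvable_of_bob_removes (RingTile.top ⟨r, hrN⟩) ?_ ?_ ?_ ih
    all_goals
      simp only [ringStructure, RingTile.rows, RingTile.cols, Finset.mem_filter_univ, belowTops, hg]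
      intros
      omega

end Rings

theorem theorem4 (m n : ℕ) (hm : 3 ≤ m) (hmn : m ≤ n) :
    LOCCDistinguishableWith ⌈(m : ℚ) / 2⌉₊ (ringStructure m n hm hmn).state := by
  have hc : ⌈(m : ℚ) / 2⌉₊ = (m - 1) / 2 + 1 := by
    rw [Nat.ceil_eq_iff (by omega)]
    obtain ⟨q, rfl | rfl⟩ : ∃ q, m = 2 * q + 1 ∨ m = 2 * q + 2 := ⟨(m - 1) / 2, by omega⟩
    · have : (2 * q + 1 - 1) / 2 = q := by omega
      rw [this, Nat.add_sub_cancel]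
      push_cast
      constructor <;> linarith
    · have : (2 * q + 2 - 1) / 2 = q := by omega
      rw [this, Nat.add_sub_cancel]
      push_cast
      constructor <;> linarith
  rw [hc]
  refine Resolvable.locc (.of_maxEntangled
    (fun i => ⟨min (i : ℕ) ((m - 1) / 2), by omega⟩) fun s => ?_)
    (TileStructure.stateNormSq_state_kronecker_ne_zero (by omega) (by omega) _)
  -- The outcome `s` merely relabels the classes by a shift, which preserves `hg`. With `k = (m - 1)
  -- / 2` no top is removed yet, so all cells are live.
  convert resolvable_belowTops (hm := hm) (hmn := hmn)
    (g := fun i => (⟨min (i : ℕ) ((m - 1) / 2), by omega⟩ : Fin ((m - 1) / 2 + 1)) + s)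
    (fun i i' => by rw [add_left_inj, Fin.mk.injEq]) _ le_rfl using 4
  ext i
  simp [belowTops]
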